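/- Let $k\ge 1$ and let $\Lambda$ be a $k$-graph: a countable small category with a functor $d:\Lambda\to\mathbb N^k$ such that whenever $d(\lambda)=m+n$ there are unique $\mu,\nu\in\Lambda$ with $\lambda=\mu\nu$, $d(\mu)=m$, $d(\nu)=n$. Paths compose as $\lambda\mu$ with $s(\lambda)=r(\mu)$, and vertices are identified with identity morphisms. If $d(\lambda)=m+n$, write $\lambda(0,m)$ for the above $\mu$. Let $\Lambda^{\min}(\lambda,\mu)$ be the set of pairs $(\rho,\tau)$ such that $\lambda\rho=\mu\tau$ and $d(\lambda\rho)=d(\lambda)\vee d(\mu)$. Assume that $\Lambda$ is finitely aligned, i.e. all sets $\Lambda^{\min}(\lambda,\mu)$ are finite. A set $E\subseteq v\Lambda=\{\lambda: r(\lambda)=v\}$ is exhaustive if for every $\lambda\in v\Lambda$ there is $\mu\in E$ with $\Lambda^{\min}(\lambda,\mu)\ne\emptyset$. For $m\in(\mathbb N\cup\{\infty\})^k$ let $\Omega_{k,m}$ be the category with objects $\{p\in\mathbb N^k:p\le m\}$ and one morphism $(p,q)$, with range $p$, source $q$ and degree $q-p$, for each $p\le q\le m$. A boundary path of degree $d(x)=m$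 is a degree-preserving functor $x:\Omega_{k,m}\to\Lambda$ such that for every $n\in\mathbb N^k$ with $n\le m$ and every finite exhaustive set $E\subseteq x(n)\Lambda\setminus\{x(n)\}$ there is $\lambda\in E$ with $n+d(\lambda)\le m$ and $x(n,n+d(\lambda))=\lambda$. Write $\partial\Lambda$ for the set of boundary paths, $r(x)=x(0)$, $\sigma^n x$ for the shift $\sigma^nx(p,q)=x(n+p,n+q)$ (for $n\le d(x)$), and, for $s(\lambda)=r(x)$, $\lambda x$ for the path $y$ of degree $d(\lambda)+d(x)$ with $y(0,d(\lambda))=\lambda$ and $\sigma^{d(\lambda)}y=x$. A boundary path $x$ is aperiodic if $\lambda x\neq\mu x$ for all $\lambda\ne\mu$ in $\Lambda$ with $s(\lambda)=s(\mu)=r(x)$; $\Lambda$ is aperiodic if for every vertex $v$ there is an aperiodic boundary path $x$ with $r(x)=v$. The boundary-path groupoid $\mathcal G_\Lambda$ has object set $\partial\Lambda$, and its morphisms are the triples $(x,m,y)\in\partial\Lambda\times\mathbb Z^k\times\partial\Lambda$ such that there are $p,q\in\mathbb N^k$ with $p\le d(x)$, $q\le d(y)$, $p-q=m$ and $\sigma^px=\sigma^qy$.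 The range and source of $(x,m,y)$ are $x$ and $y$, $(x,m,y)(y,n,z)=(x,m+n,z)$ and $(x,m,y)^{-1}=(y,-m,x)$. With $Z(\lambda)=\lambda\,\partial\Lambda$ and $$Z(\lambda *_s\mu)=\{(x,d(\lambda)-d(\mu),y): x\in Z(\lambda),\ y\in Z(\mu),\ \sigma^{d(\lambda)}x=\sigma^{d(\mu)}y\},$$ $\mathcal G_\Lambda$ carries the topology generated by the sets $$Z(\lambda *_s\mu\setminus G)=Z(\lambda*_s\mu)\setminus\bigcup_{\nu\in G}Z(\lambda\nu*_s\mu\nu),$$ where $s(\lambda)=s(\mu)$ and $G\subseteq s(\lambda)\Lambda$ is finite and non-exhaustive. $\mathcal G_\Lambda$ is effective if the interior of its isotropy $\{a\in\mathcal G_\Lambda: s(a)=r(a)\}$ equals its unit space $\{(x,0,x):x\in\partial\Lambda\}$. **Proposition.** The finitely aligned $k$-graph $\Lambda$ is aperiodic if and only if its boundary-path groupoid $\mathcal G_\Lambda$ is effective. -/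

import Mathlib

open CategoryTheory Topology

universe u v

/-- A morphism of a category, bundled with its range and its source.  Composition is written as for
paths: `f.comp g` is `fg`, defined when the source of `f` is the range of `g`. -/
@[ext]
structure Mor (C : Type u) [Category.{v} C] where
  rng : C
  src : C
  hom : src ⟶ rng

namespace Mor

variable {C : Type u} [Category.{v} C]

/-- The identity morphism at an object. -/
def id (c : C) : Mor C := ⟨c, c, 𝟙 c⟩

/-- The composite `fg` of two morphisms with `s(f) = r(g)`. -/
def comp (f g : Mor C) (h : f.src = g.rng) : Mor C :=
  ⟨f.rng, g.src, g.hom ≫ eqToHom h.symm ≫ f.hom⟩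

@[simp] theorem rng_comp (f g : Mor C) (h : f.src = g.rng) : (f.comp g h).rng = f.rng := rfl

@[simp] theorem src_comp (f g : Mor C) (h : f.src = g.rng) : (f.comp g h).src = g.src := rfl

theorem comp_id (f : Mor C) (c : C) (h : f.src = c) : f.comp (id c) h = f := by
  obtain ⟨a, b, f⟩ := f
  dsimp only at h
  subst h
  simp [comp, id]

theorem id_comp (f : Mor C) (c : C) (h : c = f.rng) : (id c).comp f h = f := by
  obtain ⟨a, b, f⟩ := f
  dsimp only at h
  subst h
  change (⟨c, b, f ≫ 𝟙 c ≫ 𝟙 c⟩ : Mor C) = ⟨c, b, f⟩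
  simp

theorem comp_assoc (f g e : Mor C) (h : f.src = g.rng) (h₁ : g.src = e.rng) :
    (f.comp g h).comp e h₁ = f.comp (g.comp e h₁) h := by
  obtain ⟨a, b, f⟩ := f
  obtain ⟨c, d, g⟩ := g
  obtain ⟨i, j, e⟩ := e
  dsimp only at h h₁
  subst h
  subst h₁
  change (⟨a, j, e ≫ 𝟙 d ≫ g ≫ 𝟙 b ≫ f⟩ : Mor C) = ⟨a, j, (e ≫ 𝟙 d ≫ g) ≫ 𝟙 b ≫ f⟩
  simp

end Mor

/-- A higher-rank graph of rank `k`: a countable small category `Λ` with a functor `d` to the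
monoid `ℕᵏ` (a category with one object) that has the unique factorisation property. -/
class HigherRankGraph (k : outParam ℕ) (Λ : Type u) [Category.{v} Λ] where
  countable_mor : Countable (Mor Λ)
  d : Mor Λ → (Fin k → ℕ)
  d_id : ∀ c : Λ, d (Mor.id c) = 0
  d_comp : ∀ (f g : Mor Λ) (h : f.src = g.rng), d (f.comp g h) = d f + d g
  factorisation : ∀ (f : Mor Λ) (m n : Fin k → ℕ), d f = m + n →
    ∃! p : Mor Λ × Mor Λ, (∃ h : p.1.src = p.2.rng, f = p.1.comp p.2 h) ∧ d p.1 = m ∧ d p.2 = n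

namespace HigherRankGraph

variable {k : ℕ} {Λ : Type u} [Category.{v} Λ] [HigherRankGraph k Λ]

/-! ### Factorisations of a path -/

theorem comp_inj {f g f₁ g₁ : Mor Λ} (h : f.src = g.rng) (h₁ : f₁.src = g₁.rng)
    (hd : d f = d f₁) (he : f.comp g h = f₁.comp g₁ h₁) : f = f₁ ∧ g = g₁ := by
  have e1 := d_comp f g h
  have e2 := d_comp f₁ g₁ h₁
  have e3 : d g = d g₁ := by
    rw [he, e2, hd] at e1
    exact (add_left_cancel e1).symm
  have := (factorisation (f.comp g h) (d f) (d g) e1).unique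
    (y₁ := (f, g)) (y₂ := (f₁, g₁)) ⟨⟨h, rfl⟩, rfl, rfl⟩ ⟨⟨h₁, he⟩, hd.symm, e3.symm⟩
  simpa using this

theorem exists_factor (f : Mor Λ) (m : Fin k → ℕ) (hm : m ≤ d f) :
    ∃ p : Mor Λ × Mor Λ, (∃ h : p.1.src = p.2.rng, f = p.1.comp p.2 h) ∧
      d p.1 = m ∧ d p.2 = d f - m :=
  (factorisation f m (d f - m) (add_tsub_cancel_of_le hm).symm).exists

/-- The initial segment `f(0, m)`, for `m ≤ d(f)`. -/
noncomputable def head (f : Mor Λ) (m : Fin k → ℕ) (hm : m ≤ d f) : Mor Λ :=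
  (exists_factor f m hm).choose.1

/-- The final segment `f(m, d(f))`, for `m ≤ d(f)`. -/
noncomputable def tail (f : Mor Λ) (m : Fin k → ℕ) (hm : m ≤ d f) : Mor Λ :=
  (exists_factor f m hm).choose.2

theorem src_head (f : Mor Λ) (m : Fin k → ℕ) (hm : m ≤ d f) :
    (head f m hm).src = (tail f m hm).rng :=
  (exists_factor f m hm).choose_spec.1.choose

theorem head_comp_tail (f : Mor Λ) (m : Fin k → ℕ) (hm : m ≤ d f) :
    (head f m hm).comp (tail f m hm) (src_head f m hm) = f :=
  (exists_factor f m hm).choose_spec.1.choose_spec.symm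

theorem d_head (f : Mor Λ) (m : Fin k → ℕ) (hm : m ≤ d f) : d (head f m hm) = m :=
  (exists_factor f m hm).choose_spec.2.1

theorem d_tail (f : Mor Λ) (m : Fin k → ℕ) (hm : m ≤ d f) : d (tail f m hm) = d f - m :=
  (exists_factor f m hm).choose_spec.2.2

theorem src_tail (f : Mor Λ) (m : Fin k → ℕ) (hm : m ≤ d f) : (tail f m hm).src = f.src := by
  conv_rhs => rw [← head_comp_tail f m hm]
  rfl

theorem head_eq {f g e : Mor Λ} (h : f.src = g.rng) (he : f.comp g h = e) {m : Fin k → ℕ}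
    (hm : m ≤ d e) (hf : d f = m) : head e m hm = f :=
  (comp_inj (src_head e m hm) h ((d_head e m hm).trans hf.symm)
    ((head_comp_tail e m hm).trans he.symm)).1

theorem head_head (f : Mor Λ) (m n : Fin k → ℕ) (hmn : m ≤ n) (hn : n ≤ d f)
    (hm : m ≤ d (head f n hn)) :
    head (head f n hn) m hm = head f m (hmn.trans hn) := by
  symm
  refine head_eq (g := (tail (head f n hn) m hm).comp (tail f n hn)
    ((src_tail _ _ _).trans (src_head f n hn))) (src_head (head f n hn) m hm) ?_ _ (d_head _ _ _)
  rw [← Mor.comp_assoc]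
  conv_rhs => rw [← head_comp_tail f n hn]
  congr 1
  exact head_comp_tail _ _ _

theorem head_of_comp (f g : Mor Λ) (h : f.src = g.rng) (m : Fin k → ℕ) (hm : m ≤ d f)
    (hm₁ : m ≤ d (f.comp g h)) : head (f.comp g h) m hm₁ = head f m hm := by
  refine head_eq (g := (tail f m hm).comp g ((src_tail _ _ _).trans h)) (src_head f m hm) ?_ _
    (d_head _ _ _)
  rw [← Mor.comp_assoc]
  congr 1
  exact head_comp_tail _ _ _

theorem eq_id_of_d_eq_zero (f : Mor Λ) (hf : d f = 0) : f = Mor.id f.src := by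
  have h1 : (f.comp (Mor.id f.src) rfl) = (Mor.id f.rng).comp f rfl :=
    (Mor.comp_id f _ rfl).trans (Mor.id_comp f _ rfl).symm
  exact (comp_inj rfl rfl (hf.trans (d_id _).symm) h1).2.symm

/-! ### Minimal common extensions, exhaustive sets, finite alignment -/

/-- `MCE(f, g)`: the paths `t` with `d(t) = d(f) ∨ d(g)`, `t(0, d(f)) = f` and `t(0, d(g)) = g`. -/
def MCE (f g : Mor Λ) : Set (Mor Λ) :=
  {t | d t = d f ⊔ d g ∧ (∃ h : d f ≤ d t, head t (d f) h = f) ∧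
    (∃ h : d g ≤ d t, head t (d g) h = g)}

/-- `Λᵐⁱⁿ(f, g)`: the pairs `(a, b)` with `fa = gb` a minimal common extension of `f` and `g`. -/
def minExt (f g : Mor Λ) : Set (Mor Λ × Mor Λ) :=
  {p | ∃ (hf : f.src = p.1.rng) (hg : g.src = p.2.rng),
    f.comp p.1 hf = g.comp p.2 hg ∧ f.comp p.1 hf ∈ MCE f g}

/-- `E ⊆ vΛ` is exhaustive. -/
def IsExhaustive (v : Λ) (E : Set (Mor Λ)) : Prop :=
  (∀ g ∈ E, g.rng = v) ∧ ∀ f : Mor Λ, f.rng = v → ∃ g ∈ E, (minExt f g).Nonempty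

/-- `E ∈ v FE(Λ)`: a finite exhaustive subset of `vΛ ∖ {v}`. -/
def IsFE (v : Λ) (E : Set (Mor Λ)) : Prop :=
  E.Finite ∧ Mor.id v ∉ E ∧ IsExhaustive v E

variable (Λ) in
/-- `Λ` is finitely aligned. -/
def FinitelyAligned : Prop := ∀ f g : Mor Λ, (minExt f g).Finite

/-! ### Paths and boundary paths -/

/-- The inclusion of `ℕᵏ` in `(ℕ ∪ {∞})ᵏ`. -/
def toInf (n : Fin k → ℕ) : Fin k → ℕ∞ := fun i => (n i : ℕ∞)

theorem toInf_mono {m n : Fin k → ℕ} (h : m ≤ n) : toInf m ≤ toInf n := fun i =>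
  Nat.cast_le.mpr (h i)

variable (Λ) in
/-- A degree-preserving functor `x : Ω_{k, deg} → Λ`.  The objects of `Ω_{k, deg}` are the
`p ∈ ℕᵏ` with `p ≤ deg`; it has exactly one morphism `(p, q)`, of range `p`, source `q` and degree
`q - p`, for each pair `p ≤ q ≤ deg`, and no others.  The value at `(p, q)` is `x.seg p q`. -/
structure GraphPath where
  deg : Fin k → ℕ∞
  obj : ∀ p : Fin k → ℕ, toInf p ≤ deg → Λ
  seg : ∀ p q : Fin k → ℕ, p ≤ q → toInf q ≤ deg → Mor Λ
  rng_seg : ∀ p q (h : p ≤ q) (hq : toInf q ≤ deg),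
    (seg p q h hq).rng = obj p ((toInf_mono h).trans hq)
  src_seg : ∀ p q (h : p ≤ q) (hq : toInf q ≤ deg), (seg p q h hq).src = obj q hq
  seg_self : ∀ p (hp : toInf p ≤ deg), seg p p le_rfl hp = Mor.id (obj p hp)
  seg_comp : ∀ p q r (hpq : p ≤ q) (hqr : q ≤ r) (hr : toInf r ≤ deg),
    seg p r (hpq.trans hqr) hr =
      (seg p q hpq ((toInf_mono hqr).trans hr)).comp (seg q r hqr hr)
        ((src_seg p q hpq _).trans (rng_seg q r hqr hr).symm)
  d_seg : ∀ p q (h : p ≤ q) (hq : toInf q ≤ deg), d (seg p q h hq) = q - p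

theorem toInf_zero_le (m : Fin k → ℕ∞) : toInf 0 ≤ m := fun i => by simp [toInf]

namespace GraphPath

/-- The range `x(0)` of a path. -/
def range (x : GraphPath Λ) : Λ := x.obj 0 (toInf_zero_le _)

theorem add_le_of_le_sub {m : Fin k → ℕ∞} {n q : Fin k → ℕ} (hn : toInf n ≤ m)
    (hq : toInf q ≤ m - toInf n) : toInf (n + q) ≤ m := fun i => by
  have h1 := hn i
  have h2 := hq i
  simp only [toInf, Pi.sub_apply, Pi.add_apply, Nat.cast_add] at *
  calc (n i : ℕ∞) + q i ≤ n i + (m i - n i) := by gcongr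
    _ = m i := add_tsub_cancel_of_le h1

/-- The shift `σⁿx`, for `n ≤ d(x)`: it has degree `d(x) - n` and `σⁿx(p, q) = x(n + p, n + q)`. -/
def shift (x : GraphPath Λ) (n : Fin k → ℕ) (hn : toInf n ≤ x.deg) : GraphPath Λ where
  deg := x.deg - toInf n
  obj p hp := x.obj (n + p) (add_le_of_le_sub hn hp)
  seg p q h hq := x.seg (n + p) (n + q) (add_le_add le_rfl h) (add_le_of_le_sub hn hq)
  rng_seg _ _ _ _ := x.rng_seg _ _ _ _
  src_seg _ _ _ _ := x.src_seg _ _ _ _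
  seg_self _ _ := x.seg_self _ _
  seg_comp _ _ _ hpq hqr _ :=
    x.seg_comp _ _ _ (add_le_add le_rfl hpq) (add_le_add le_rfl hqr) _
  d_seg p q h hq := by
    rw [x.d_seg]
    exact add_tsub_add_eq_tsub_left _ _ _

theorem ext_seg {x y : GraphPath Λ} (hd : x.deg = y.deg)
    (hs : ∀ p q h hx hy, x.seg p q h hx = y.seg p q h hy) : x = y := by
  have ho : ∀ p hx hy, x.obj p hx = y.obj p hy := fun p hx hy => by
    have h1 := hs p p le_rfl hx hy
    rw [x.seg_self, y.seg_self] at h1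
    exact congrArg Mor.rng h1
  cases x
  cases y
  cases hd
  congr
  · funext p hp; exact ho p hp hp
  · funext p q h hq; exact hs p q h hq hq

/-- The path of degree `m` whose initial segments `y(0, q)` are a given coherent family. -/
noncomputable def ofHeads (m : Fin k → ℕ∞) (y : ∀ q : Fin k → ℕ, toInf q ≤ m → Mor Λ)
    (hd : ∀ q hq, d (y q hq) = q)
    (hy : ∀ p q (h : p ≤ q) (hq : toInf q ≤ m),
      head (y q hq) p (h.trans (hd q hq).ge) = y p ((toInf_mono h).trans hq)) : GraphPath Λ where
  deg := m
  obj p hp := (y p hp).src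
  seg p q h hq := tail (y q hq) p (h.trans (hd q hq).ge)
  rng_seg p q h hq := by
    rw [← hy p q h hq]
    exact (src_head _ _ _).symm
  src_seg p q h hq := src_tail _ _ _
  seg_self p hp := by
    refine (eq_id_of_d_eq_zero _ ?_).trans (congrArg Mor.id (src_tail _ _ _))
    rw [d_tail, hd]
    exact tsub_self _
  seg_comp p q r hpq hqr hr := by
    have a1 : (head (y r hr) q (hqr.trans (hd r hr).ge)) = y q ((toInf_mono hqr).trans hr) :=
      hy q r hqr hr
    have a2 := hy p q hpq ((toInf_mono hqr).trans hr)
    have a3 := hy p r (hpq.trans hqr) hr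
    have c1 := src_head (y q ((toInf_mono hqr).trans hr)) p
      (hpq.trans (hd q ((toInf_mono hqr).trans hr)).ge)
    have c2 : (tail (y q ((toInf_mono hqr).trans hr)) p
        (hpq.trans (hd q ((toInf_mono hqr).trans hr)).ge)).src
        = (tail (y r hr) q (hqr.trans (hd r hr).ge)).rng := by
      rw [src_tail, ← a1]
      exact src_head _ _ _
    refine (comp_inj (src_head (y r hr) p ((hpq.trans hqr).trans (hd r hr).ge))
      (f₁ := head (y q ((toInf_mono hqr).trans hr)) p
        (hpq.trans (hd q ((toInf_mono hqr).trans hr)).ge)) ?_ ?_ ?_).2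
    · exact c1
    · rw [d_head, d_head]
    · rw [head_comp_tail, ← Mor.comp_assoc]
      · conv_lhs => rw [← head_comp_tail (y r hr) q (hqr.trans (hd r hr).ge)]
        congr 1
        exact a1.trans (head_comp_tail _ _ _).symm
  d_seg p q h hq := by rw [d_tail, hd]

theorem sub_le_of_le_add {m : Fin k → ℕ∞} {n q : Fin k → ℕ}
    (hq : toInf q ≤ toInf n + m) : toInf (q - n) ≤ m := fun i => by
  have h := hq i
  simp only [toInf, Pi.sub_apply, Pi.add_apply, ENat.natCast_sub] at *
  exact tsub_le_iff_left.mpr h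

theorem src_eq_rng_seg (f : Mor Λ) (x : GraphPath Λ) (h : f.src = x.range) (q : Fin k → ℕ)
    (hq : toInf q ≤ x.deg) : f.src = (x.seg 0 q zero_le hq).rng := by
  rw [x.rng_seg]
  exact h

/-- `f x(0, q ∸ d(f))`, a path of degree `d(f) ∨ q`. -/
def preConcat (f : Mor Λ) (x : GraphPath Λ) (h : f.src = x.range) (q : Fin k → ℕ)
    (hq : toInf q ≤ toInf (d f) + x.deg) : Mor Λ :=
  f.comp (x.seg 0 (q - d f) zero_le (sub_le_of_le_add hq)) (src_eq_rng_seg f x h _ _)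

theorem le_d_preConcat (f : Mor Λ) (x : GraphPath Λ) (h : f.src = x.range) (q : Fin k → ℕ)
    (hq : toInf q ≤ toInf (d f) + x.deg) : q ≤ d (preConcat f x h q hq) := by
  rw [preConcat, d_comp, x.d_seg, tsub_zero]
  exact le_add_tsub

/-- The concatenation `fx` of `f ∈ Λ` and a path `x` with `s(f) = r(x)`: it has degree
`d(f) + d(x)`, and `(fx)(0, q)` is the initial segment of degree `q` of `f x(0, q ∸ d(f))`. -/
noncomputable def concat (f : Mor Λ) (x : GraphPath Λ) (h : f.src = x.range) : GraphPath Λ :=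
  ofHeads (toInf (d f) + x.deg)
    (fun q hq => head (preConcat f x h q hq) q (le_d_preConcat f x h q hq))
    (fun _ _ => d_head _ _ _)
    (fun p q hpq hq => by
      rw [head_head _ _ _ hpq]
      have hp := (toInf_mono hpq).trans hq
      have e : preConcat f x h q hq = (preConcat f x h p hp).comp
          (x.seg (p - d f) (q - d f) (tsub_le_tsub_right hpq _) (sub_le_of_le_add hq))
          ((x.src_seg _ _ _ _).trans (x.rng_seg _ _ _ _).symm) := by
        unfold preConcat
        rw [Mor.comp_assoc]
        congr 1
        exact x.seg_comp 0 (p - d f) (q - d f) zero_le (tsub_le_tsub_right hpq _) _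
      have key : ∀ (g : Mor Λ) (hg : p ≤ d g), g = (preConcat f x h p hp).comp
          (x.seg (p - d f) (q - d f) (tsub_le_tsub_right hpq _) (sub_le_of_le_add hq))
          ((x.src_seg _ _ _ _).trans (x.rng_seg _ _ _ _).symm) →
          head g p hg = head (preConcat f x h p hp) p (le_d_preConcat f x h p hp) := by
        rintro g hg rfl
        exact head_of_comp _ _ _ _ _ _
      exact key _ _ e)

/-- The initial segment of degree `d(f)` of `fx` is `f`. -/
theorem concat_seg_zero (f : Mor Λ) (x : GraphPath Λ) (h : f.src = x.range)
    (hf : toInf (d f) ≤ (concat f x h).deg) :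
    (concat f x h).seg 0 (d f) zero_le hf = f := by
  have e : head (preConcat f x h (d f) hf) (d f) (le_d_preConcat f x h _ hf) = f :=
    head_eq (src_eq_rng_seg f x h _ _) rfl _ rfl
  have h0 := head_comp_tail (head (preConcat f x h (d f) hf) (d f) (le_d_preConcat f x h _ hf))
    0 zero_le
  have h1 : (concat f x h).seg 0 (d f) zero_le hf =
    tail (head (preConcat f x h (d f) hf) (d f) (le_d_preConcat f x h _ hf)) 0 zero_le := rfl
  rw [h1]
  have h2 : (Mor.id f.rng).comp f rfl = f := Mor.id_comp _ _ _
  exact ((comp_inj _ rfl ((d_head _ _ _).trans (d_id _).symm) (h0.trans (e.trans h2.symm))).2)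

/-- `x` is a boundary path: for every `n ≤ d(x)` and every `E ∈ x(n) FE(Λ)` there is `f ∈ E` with
`x(n, n + d(f)) = f`. -/
def IsBoundary (x : GraphPath Λ) : Prop :=
  ∀ (n : Fin k → ℕ) (hn : toInf n ≤ x.deg) (E : Set (Mor Λ)), IsFE (x.obj n hn) E →
    ∃ f ∈ E, ∃ h : toInf (n + d f) ≤ x.deg, x.seg n (n + d f) le_self_add h = f

/-- `x` is aperiodic: `fx ≠ gx` for all `f ≠ g` in `Λ r(x)`. -/
def IsAperiodic (x : GraphPath Λ) : Prop :=
  ∀ (f g : Mor Λ) (hf : f.src = x.range) (hg : g.src = x.range), f ≠ g →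
    concat f x hf ≠ concat g x hg

theorem shift_shift (x : GraphPath Λ) (m n : Fin k → ℕ) (hm : toInf m ≤ x.deg)
    (hn : toInf n ≤ (x.shift m hm).deg) (hmn : toInf (m + n) ≤ x.deg) :
    (x.shift m hm).shift n hn = x.shift (m + n) hmn := by
  refine ext_seg ?_ ?_
  · funext i
    simp only [shift, toInf, Pi.sub_apply, Pi.add_apply, Nat.cast_add]
    exact tsub_tsub _ _ _
  · intro p q h hx hy
    simp only [shift]
    congr 1 <;> exact (add_assoc _ _ _).symm

theorem le_shift_deg {m : Fin k → ℕ∞} {n r : Fin k → ℕ} (hr : toInf r ≤ m) :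
    toInf (r - n) ≤ m - toInf n := fun i => by
  simp only [toInf, Pi.sub_apply, ENat.natCast_sub]
  exact tsub_le_tsub_right (hr i) _

end GraphPath

variable (Λ) in
/-- The set `∂Λ` of boundary paths. -/
def BoundaryPath : Type (max u v) := {x : GraphPath Λ // x.IsBoundary}

variable (Λ) in
/-- `Λ` is aperiodic: every vertex is the range of an aperiodic boundary path. -/
def Aperiodic : Prop := ∀ w : Λ, ∃ x : BoundaryPath Λ, x.1.range = w ∧ x.1.IsAperiodic

/-! ### The boundary-path groupoid -/

/-- `(x, m, y)` is a morphism of the boundary-path groupoid: there are `p ≤ d(x)` and `q ≤ d(y)`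
with `p - q = m` and `σᵖx = σ^q y`. -/
def IsLag (x : BoundaryPath Λ) (m : Fin k → ℤ) (y : BoundaryPath Λ) : Prop :=
  ∃ (p q : Fin k → ℕ) (hp : toInf p ≤ x.1.deg) (hq : toInf q ≤ y.1.deg),
    (∀ i, (p i : ℤ) - (q i : ℤ) = m i) ∧ x.1.shift p hp = y.1.shift q hq

theorem isLag_zero (x : BoundaryPath Λ) : IsLag x 0 x :=
  ⟨0, 0, toInf_zero_le _, toInf_zero_le _, by simp, rfl⟩

theorem IsLag.symm {x y : BoundaryPath Λ} {m : Fin k → ℤ} (h : IsLag x m y) : IsLag y (-m) x := by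
  obtain ⟨p, q, hp, hq, hm, hs⟩ := h
  exact ⟨q, p, hq, hp, fun i => by simp [← hm i], hs.symm⟩

theorem shift_congr {x y : GraphPath Λ} {p q n : Fin k → ℕ} {hp : toInf p ≤ x.deg}
    {hq : toInf q ≤ y.deg} (hs : x.shift p hp = y.shift q hq) (hn : toInf n ≤ (y.shift q hq).deg) :
    ∃ (h₁ : toInf (p + n) ≤ x.deg) (h₂ : toInf (q + n) ≤ y.deg),
      x.shift (p + n) h₁ = y.shift (q + n) h₂ := by
  have hn₁ : toInf n ≤ (x.shift p hp).deg := by rw [hs]; exact hn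
  refine ⟨GraphPath.add_le_of_le_sub hp hn₁, GraphPath.add_le_of_le_sub hq hn, ?_⟩
  rw [← GraphPath.shift_shift x p n hp hn₁, ← GraphPath.shift_shift y q n hq hn]
  congr 1

theorem IsLag.trans {x y z : BoundaryPath Λ} {m n : Fin k → ℤ} (h : IsLag x m y)
    (h₁ : IsLag y n z) : IsLag x (m + n) z := by
  obtain ⟨p, q, hp, hq, hm, hs⟩ := h
  obtain ⟨p₁, q₁, hp₁, hq₁, hn, hs₁⟩ := h₁
  have hr : toInf (q ⊔ p₁) ≤ y.1.deg := fun i => by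
    have a := hq i
    have b := hp₁ i
    simp only [toInf, Pi.sup_apply] at *
    exact max_le a b
  obtain ⟨a1, a2, a3⟩ := shift_congr hs
    (GraphPath.le_shift_deg (n := q) hr)
  obtain ⟨b1, b2, b3⟩ := shift_congr hs₁.symm
    (GraphPath.le_shift_deg (n := p₁) hr)
  refine ⟨_, _, a1, b1, fun i => ?_, ?_⟩
  · have e1 := hm i
    have e2 := hn i
    simp only [Pi.add_apply, Pi.sub_apply, Pi.sup_apply]
    have l1 : q i ≤ q i ⊔ p₁ i := le_sup_left
    have l2 : p₁ i ≤ q i ⊔ p₁ i := le_sup_right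
    omega
  · rw [a3, b3]
    congr 1
    rw [add_tsub_cancel_of_le le_sup_left, add_tsub_cancel_of_le le_sup_right]

/-- The boundary-path groupoid of `Λ`, with object set `∂Λ`.  A morphism `y ⟶ x`, which has source
`y` and range `x`, is a triple `(x, m, y)`; composition is `(x, m, y)(y, n, z) = (x, m + n, z)` and
the inverse of `(x, m, y)` is `(y, -m, x)`. -/
instance : Groupoid (BoundaryPath Λ) where
  Hom y x := {m : Fin k → ℤ // IsLag x m y}
  id x := ⟨0, isLag_zero x⟩
  comp f g := ⟨g.1 + f.1, g.2.trans f.2⟩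
  inv f := ⟨-f.1, f.2.symm⟩
  id_comp _ := Subtype.ext (add_zero _)
  comp_id _ := Subtype.ext (zero_add _)
  assoc _ _ _ := Subtype.ext (add_assoc _ _ _).symm
  inv_comp _ := Subtype.ext (add_neg_cancel _)
  comp_inv _ := Subtype.ext (neg_add_cancel _)

/-- The middle entry `m` of a morphism `(x, m, y)` of the boundary-path groupoid. -/
def lag (a : Mor (BoundaryPath Λ)) : Fin k → ℤ := Subtype.val a.hom

/-- `Z(f) = f ∂Λ`. -/
def cylinder (f : Mor Λ) : Set (BoundaryPath Λ) :=
  {y | ∃ (x : BoundaryPath Λ) (h : f.src = x.1.range), y.1 = GraphPath.concat f x.1 h}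

/-- `Z(f *ₛ g)`: the morphisms `(x, d(f) - d(g), y)` with `x ∈ Z(f)`, `y ∈ Z(g)` and
`σ^{d(f)} x = σ^{d(g)} y`. -/
def bisection (f g : Mor Λ) : Set (Mor (BoundaryPath Λ)) :=
  {a | a.rng ∈ cylinder f ∧ a.src ∈ cylinder g ∧ (∀ i, lag a i = (d f i : ℤ) - (d g i : ℤ)) ∧
    ∃ (hf : toInf (d f) ≤ a.rng.1.deg) (hg : toInf (d g) ≤ a.src.1.deg),
      a.rng.1.shift (d f) hf = a.src.1.shift (d g) hg}

/-- `Z(f *ₛ g ∖ G) = Z(f *ₛ g) ∖ ⋃_{e ∈ G} Z(fe *ₛ ge)`. -/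
def bisectionDiff (f g : Mor Λ) (G : Set (Mor Λ)) : Set (Mor (BoundaryPath Λ)) :=
  bisection f g \
    {a | ∃ e ∈ G, ∃ (hf : f.src = e.rng) (hg : g.src = e.rng),
      a ∈ bisection (f.comp e hf) (g.comp e hg)}

/-- The topology of the boundary-path groupoid: the one generated by the sets `Z(f *ₛ g ∖ G)` with
`s(f) = s(g)` and `G ⊆ s(f)Λ` finite and not exhaustive. -/
instance : TopologicalSpace (Mor (BoundaryPath Λ)) :=
  TopologicalSpace.generateFrom
    {U | ∃ (f g : Mor Λ) (G : Set (Mor Λ)), f.src = g.src ∧ G.Finite ∧ (∀ e ∈ G, e.rng = f.src) ∧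
      ¬ IsExhaustive f.src G ∧ U = bisectionDiff f g G}

end HigherRankGraph

/-! ### Effective groupoids -/

/-- The isotropy of a groupoid: the morphisms whose source and range agree. -/
def isotropy (G : Type u) [Groupoid.{v} G] : Set (Mor G) := {a | a.src = a.rng}

/-- The unit space of a groupoid, as a set of morphisms: the identities. -/
def unitSpace (G : Type u) [Groupoid.{v} G] : Set (Mor G) := Set.range Mor.id

/-- A groupoid with a topology on its set of morphisms is effective if the interior of its isotropy
is its unit space. -/
def IsEffective (G : Type u) [Groupoid.{v} G] [TopologicalSpace (Mor G)] : Prop :=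
  interior (isotropy G) = unitSpace G

/-! A path `x` is determined by its set of initial segments (`ext_init`), so boundary conditions,
concatenation and shifts all become statements about the order `Pre` on `Λ`.

Aperiodic implies effective: a point of the interior of the isotropy has a neighbourhood cut out of
some `Z(f *ₛ g)` by forbidding finitely many initial segments of the range
(`exists_bisection_of_isOpen`). Some extension `fr` is incompatible with all the forbidden paths
(`exists_avoiding`). For an aperiodic boundary path `z` at `s(r)`, the morphism from `grz` to `frz`
lies in the neighbourhood, so `frz = grz`. Hence `fr = gr`, so `f = g`, and the point is a unit.

Effective implies aperiodic: if no aperiodic boundary path starts at some vertex, a Baire-type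
construction (`exists_isBoundary_meeting`, via `exists_isAperiodic`) yields `f ≠ g` with a common
source such that `fa` and `ga` always have a common extension. Finite alignment then gives `fx = gx`
for every boundary path `x` (`concat_eq_of_common`), so the open set `Z(f *ₛ g)` consists of
isotropy. Effectiveness forces `d(f) = d(g)`, hence `f = g`, a contradiction. -/

namespace Mor

/-! ### The initial-segment preorder on the morphisms of a category. -/

variable {C : Type u} [Category.{v} C]

/-- `f` is an initial segment of `g`. -/
def Pre (f g : Mor C) : Prop := ∃ (e : Mor C) (h : f.src = e.rng), f.comp e h = g

theorem Pre.refl (f : Mor C) : Pre f f := ⟨id f.src, rfl, comp_id _ _ _⟩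

theorem Pre.trans {f g e : Mor C} (h : Pre f g) (h₁ : Pre g e) : Pre f e := by
  obtain ⟨a, ha, rfl⟩ := h
  obtain ⟨b, hb, rfl⟩ := h₁
  exact ⟨a.comp b hb, ha, (comp_assoc _ _ _ _ _).symm⟩

theorem Pre.rng_eq {f g : Mor C} (h : Pre f g) : f.rng = g.rng := by
  obtain ⟨a, ha, rfl⟩ := h
  rfl

theorem pre_comp (f e : Mor C) (h : f.src = e.rng) : Pre f (f.comp e h) := ⟨e, h, rfl⟩

theorem Pre.comp_left {e g : Mor C} (f : Mor C) (h : f.src = e.rng) (h₁ : f.src = g.rng)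
    (hp : Pre e g) : Pre (f.comp e h) (f.comp g h₁) := by
  obtain ⟨a, ha, rfl⟩ := hp
  exact ⟨a, ha, comp_assoc _ _ _ _ _⟩

end Mor

namespace HigherRankGraph

open Mor

variable {k : ℕ} {Λ : Type u} [Category.{v} Λ] [HigherRankGraph k Λ]

/-! ### Initial segments and common extensions -/

theorem d_mono {f g : Mor Λ} (h : Pre f g) : d f ≤ d g := by
  obtain ⟨a, ha, rfl⟩ := h
  rw [d_comp]
  exact le_self_add

theorem pre_head (f : Mor Λ) (m : Fin k → ℕ) (hm : m ≤ d f) : Pre (head f m hm) f :=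
  ⟨_, src_head f m hm, head_comp_tail f m hm⟩

theorem head_eq_of_pre {f g : Mor Λ} (h : Pre f g) {m : Fin k → ℕ} (hm : m ≤ d g)
    (hf : d f = m) : head g m hm = f := by
  obtain ⟨a, ha, rfl⟩ := h
  exact head_eq ha rfl hm hf

theorem eq_of_pre_of_pre {f g t : Mor Λ} (hf : Pre f t) (hg : Pre g t) (h : d f = d g) : f = g :=
  (head_eq_of_pre hf (d_mono hg) h).symm.trans (head_eq_of_pre hg (d_mono hg) rfl)

theorem pre_of_pre_of_le {f g t : Mor Λ} (hf : Pre f t) (hg : Pre g t) (h : d f ≤ d g) :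
    Pre f g := by
  have h1 := pre_head g (d f) h
  rwa [eq_of_pre_of_pre (h1.trans hg) hf (d_head _ _ _)] at h1

/-- Cancellation comes from unique factorisation. The degree functor does not occur in the
statement, hence the explicit binders for `k` and the instance. -/
theorem comp_left_cancel {k : ℕ} [HigherRankGraph k Λ]
    {f a b : Mor Λ} {ha : f.src = a.rng} {hb : f.src = b.rng}
    (h : f.comp a ha = f.comp b hb) : a = b :=
  (comp_inj ha hb rfl h).2

theorem comp_right_cancel {k : ℕ} [HigherRankGraph k Λ]
    {f g a : Mor Λ} {hf : f.src = a.rng} {hg : g.src = a.rng}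
    (h : f.comp a hf = g.comp a hg) : f = g := by
  refine (comp_inj hf hg ?_ h).1
  have := congrArg d h
  rw [d_comp, d_comp] at this
  exact add_right_cancel this

theorem pre_of_comp_pre {k : ℕ} [HigherRankGraph k Λ]
    {f a b : Mor Λ} {ha : f.src = a.rng} {hb : f.src = b.rng}
    (h : Pre (f.comp a ha) (f.comp b hb)) : Pre a b := by
  obtain ⟨e, he, h⟩ := h
  rw [Mor.comp_assoc f a e ha he] at h
  exact ⟨e, he, comp_left_cancel h⟩

/-- The segment of `t` of degree `d f ⊔ d g` contains both `f` and `g`, because initial segments of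
one path are ordered by their degrees. -/
theorem exists_minExt_pre {f g t : Mor Λ} (hf : Pre f t) (hg : Pre g t) :
    ∃ p ∈ minExt f g, ∃ h : f.src = p.1.rng, Pre (f.comp p.1 h) t := by
  have hm : d f ⊔ d g ≤ d t := sup_le (d_mono hf) (d_mono hg)
  have h0 := pre_head t _ hm
  have hd := d_head t _ hm
  set s := head t _ hm
  have h1 : Pre f s := pre_of_pre_of_le hf h0 (hd ▸ le_sup_left)
  have h2 : Pre g s := pre_of_pre_of_le hg h0 (hd ▸ le_sup_right)
  have hs : s ∈ MCE f g := ⟨hd, ⟨d_mono h1, head_eq_of_pre h1 _ rfl⟩,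
    ⟨d_mono h2, head_eq_of_pre h2 _ rfl⟩⟩
  obtain ⟨a, ha, ea⟩ := h1
  obtain ⟨b, hb, eb⟩ := h2
  exact ⟨(a, b), ⟨ha, hb, ea.trans eb.symm, ea ▸ hs⟩, ha, ea ▸ h0⟩

theorem pre_of_mem_minExt {f g : Mor Λ} {p : Mor Λ × Mor Λ} (hp : p ∈ minExt f g)
    (h : f.src = p.1.rng) : Pre g (f.comp p.1 h) := by
  obtain ⟨_, hg, e, _⟩ := hp
  exact ⟨p.2, hg, e.symm⟩

/-- Lets exhaustiveness be tested on arbitrary common extensions, with no minimality to check. -/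
theorem minExt_nonempty_iff {f g : Mor Λ} :
    (minExt f g).Nonempty ↔ ∃ t, Pre f t ∧ Pre g t := by
  constructor
  · rintro ⟨p, hp⟩
    have ⟨h, _⟩ := hp
    exact ⟨_, pre_comp f _ h, pre_of_mem_minExt hp h⟩
  · rintro ⟨t, hf, hg⟩
    obtain ⟨p, hp, _⟩ := exists_minExt_pre hf hg
    exact ⟨p, hp⟩

/-- `Ext(f; E)`: the paths `a` such that `fa` is a minimal common extension of `f` and a member
of `E`. -/
def extSet (f : Mor Λ) (E : Set (Mor Λ)) : Set (Mor Λ) := ⋃ e ∈ E, Prod.fst '' minExt f e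

theorem mem_extSet {f a : Mor Λ} {E : Set (Mor Λ)} :
    a ∈ extSet f E ↔ ∃ e ∈ E, ∃ b, (a, b) ∈ minExt f e := by
  simp [extSet]

theorem extSet_finite (hΛ : FinitelyAligned Λ) (f : Mor Λ) {E : Set (Mor Λ)} (hE : E.Finite) :
    (extSet f E).Finite :=
  hE.biUnion fun e _ => (hΛ f e).image _

theorem rng_of_mem_extSet {f a : Mor Λ} {E : Set (Mor Λ)} (h : a ∈ extSet f E) :
    f.src = a.rng := by
  obtain ⟨e, _, b, h, _⟩ := mem_extSet.mp h
  exact h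

theorem exists_pre_of_mem_extSet {f a : Mor Λ} {E : Set (Mor Λ)} (h : a ∈ extSet f E) :
    ∃ e ∈ E, Pre e (f.comp a (rng_of_mem_extSet h)) := by
  obtain ⟨e, he, b, hb⟩ := mem_extSet.mp h
  exact ⟨e, he, pre_of_mem_minExt hb _⟩

theorem exists_mem_extSet {f e t : Mor Λ} {E : Set (Mor Λ)} (he : e ∈ E) (hf : Pre f t)
    (het : Pre e t) : ∃ a ∈ extSet f E, ∃ h : f.src = a.rng, Pre (f.comp a h) t := by
  obtain ⟨p, hp, h, h1⟩ := exists_minExt_pre hf het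
  exact ⟨p.1, mem_extSet.mpr ⟨e, he, p.2, hp⟩, h, h1⟩

/-- If every extension of `f` has a common extension with a member of `E`, then `Ext(f; E)` is
exhaustive. -/
theorem isExhaustive_extSet {f : Mor Λ} {E : Set (Mor Λ)}
    (hE : ∀ t, Pre f t → ∃ e ∈ E, ∃ s, Pre t s ∧ Pre e s) :
    IsExhaustive f.src (extSet f E) := by
  refine ⟨fun a ha => (rng_of_mem_extSet ha).symm, fun r hr => ?_⟩
  obtain ⟨e, he, s, hs, hes⟩ := hE _ (pre_comp f r hr.symm)
  obtain ⟨a, ha, h, h1⟩ := exists_mem_extSet he ((pre_comp f r hr.symm).trans hs) hes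
  obtain ⟨b, hb, rfl⟩ := (pre_comp f r hr.symm).trans hs
  exact ⟨a, ha, minExt_nonempty_iff.mpr ⟨b, pre_of_comp_pre hs, pre_of_comp_pre h1⟩⟩

namespace GraphPath

/-! ### Initial segments of paths -/

/-- `f` is an initial segment of `x`. -/
def Init (x : GraphPath Λ) (f : Mor Λ) : Prop :=
  ∃ h : toInf (d f) ≤ x.deg, x.seg 0 (d f) zero_le h = f

theorem init_seg (x : GraphPath Λ) (n : Fin k → ℕ) (hn : toInf n ≤ x.deg) :
    x.Init (x.seg 0 n zero_le hn) := by
  have h : d (x.seg 0 n zero_le hn) = n := by rw [x.d_seg, tsub_zero]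
  unfold Init
  simp only [h]
  exact ⟨hn, trivial⟩

theorem d_seg_zero (x : GraphPath Λ) (n : Fin k → ℕ) (hn : toInf n ≤ x.deg) :
    d (x.seg 0 n zero_le hn) = n := by rw [x.d_seg, tsub_zero]

theorem seg_pre_seg (x : GraphPath Λ) {m n : Fin k → ℕ} (hmn : m ≤ n) (hn : toInf n ≤ x.deg) :
    Pre (x.seg 0 m zero_le ((toInf_mono hmn).trans hn)) (x.seg 0 n zero_le hn) :=
  ⟨_, _, (x.seg_comp 0 m n zero_le hmn hn).symm⟩

theorem Init.eq_seg {x : GraphPath Λ} {f : Mor Λ} (h : x.Init f) {n : Fin k → ℕ} (hd : d f = n)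
    (hn : toInf n ≤ x.deg) : f = x.seg 0 n zero_le hn := by
  subst hd
  exact h.2.symm

theorem Init.pre_of_le {x : GraphPath Λ} {f g : Mor Λ} (hf : x.Init f) (hg : x.Init g)
    (h : d f ≤ d g) : Pre f g := by
  have := x.seg_pre_seg h hg.1
  rwa [← hf.eq_seg rfl, ← hg.eq_seg rfl] at this

theorem Init.eq_of_d_eq {x : GraphPath Λ} {f g : Mor Λ} (hf : x.Init f) (hg : x.Init g)
    (h : d f = d g) : f = g :=
  eq_of_pre_of_pre (hf.pre_of_le hg h.le) (Pre.refl g) h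

theorem Init.of_pre {x : GraphPath Λ} {f g : Mor Λ} (hg : x.Init g) (h : Pre f g) : x.Init f := by
  have hn : toInf (d f) ≤ x.deg := (toInf_mono (d_mono h)).trans hg.1
  have h1 := x.init_seg _ hn
  have h2 := d_seg_zero x _ hn
  rwa [← eq_of_pre_of_pre h (h1.pre_of_le hg (h2.trans_le (d_mono h))) h2.symm] at h1

theorem toInf_sup_le {m n : Fin k → ℕ} {t : Fin k → ℕ∞} (hm : toInf m ≤ t) (hn : toInf n ≤ t) :
    toInf (m ⊔ n) ≤ t := fun i => by
  have a := hm i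
  have b := hn i
  simp only [toInf, Pi.sup_apply] at *
  exact max_le a b

theorem Init.exists_common {x : GraphPath Λ} {f g : Mor Λ} (hf : x.Init f) (hg : x.Init g) :
    ∃ t, x.Init t ∧ Pre f t ∧ Pre g t := by
  have h := toInf_sup_le hf.1 hg.1
  have h1 := x.init_seg _ h
  have h2 := x.d_seg_zero _ h
  exact ⟨_, h1, hf.pre_of_le h1 (le_sup_left.trans h2.ge),
    hg.pre_of_le h1 (le_sup_right.trans h2.ge)⟩

theorem init_id_range (x : GraphPath Λ) : x.Init (Mor.id x.range) := by
  have h := x.init_seg 0 (toInf_zero_le _)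
  rwa [x.seg_self] at h

theorem Init.rng_eq {x : GraphPath Λ} {f : Mor Λ} (h : x.Init f) : f.rng = x.range := by
  rw [← h.2]
  exact x.rng_seg _ _ _ _

theorem Init.src_eq {x : GraphPath Λ} {f : Mor Λ} (h : x.Init f) {n : Fin k → ℕ} (hd : d f = n)
    (hn : toInf n ≤ x.deg) : f.src = x.obj n hn := by
  rw [h.eq_seg hd hn]
  exact x.src_seg _ _ _ _

theorem init_comp_seg (x : GraphPath Λ) {f : Mor Λ} (h : x.Init f) {n m : Fin k → ℕ}
    (hd : d f = n) (hnm : n ≤ m) (hm : toInf m ≤ x.deg) :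
    ∃ h₁ : f.src = (x.seg n m hnm hm).rng, f.comp (x.seg n m hnm hm) h₁ = x.seg 0 m zero_le hm := by
  have hn := (toInf_mono hnm).trans hm
  have e := h.eq_seg hd hn
  subst e
  exact ⟨_, (x.seg_comp 0 n m zero_le hnm hm).symm⟩

/-- The degree is the supremum of the degrees of initial segments, and the segment from `p` to `q`
is recovered from those of degrees `p` and `q` by left cancellation. -/
theorem ext_init {x y : GraphPath Λ} (h : ∀ f, x.Init f ↔ y.Init f) : x = y := by
  have key : ∀ {x y : GraphPath Λ}, (∀ f, x.Init f ↔ y.Init f) → x.deg ≤ y.deg := by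
    intro x y h i
    refine ENat.forall_natCast_le_iff_le.mp fun n hn => ?_
    -- Degrees may be infinite, so each coordinate is compared through finite test degrees supported
    -- on it.
    have h1 : toInf (Pi.single i n) ≤ x.deg := fun j => by
      by_cases hj : j = i
      · subst hj; simpa [toInf] using hn
      · simp [toInf, hj]
    have h2 := ((h _).mp (x.init_seg _ h1)).1 i
    rw [x.d_seg_zero] at h2
    simpa [toInf] using h2
  refine ext_seg (le_antisymm (key h) (key fun f => (h f).symm)) fun p q hpq hx hy => ?_
  have hf := x.init_seg p ((toInf_mono hpq).trans hx)
  have hd := x.d_seg_zero p ((toInf_mono hpq).trans hx)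
  obtain ⟨h1, e1⟩ := x.init_comp_seg hf hd hpq hx
  obtain ⟨h2, e2⟩ := y.init_comp_seg ((h _).mp hf) hd hpq hy
  have e3 : x.seg 0 q zero_le hx = y.seg 0 q zero_le hy :=
    ((h _).mp (x.init_seg q hx)).eq_seg (x.d_seg_zero q hx) hy
  exact comp_left_cancel (e1.trans (e3.trans e2.symm))

theorem isBoundary_iff {x : GraphPath Λ} : x.IsBoundary ↔
    ∀ f, x.Init f → ∀ E, IsFE f.src E → ∃ e ∈ E, ∃ h : f.src = e.rng, x.Init (f.comp e h) := by
  constructor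
  · intro H f hf E hE
    rw [hf.src_eq rfl hf.1] at hE
    obtain ⟨e, he, h, h1⟩ := H _ hf.1 E hE
    obtain ⟨h2, e2⟩ := x.init_comp_seg hf rfl le_self_add h
    refine ⟨e, he, h2.trans (congrArg Mor.rng h1), ?_⟩
    have h3 := x.init_seg _ h
    rw [← e2] at h3
    simpa only [h1] using h3
  · intro H n hn E hE
    have hf := x.init_seg n hn
    have hd := x.d_seg_zero n hn
    rw [← hf.src_eq hd hn] at hE
    obtain ⟨e, he, h, h1⟩ := H _ hf E hE
    have h2 := h1.1
    have e2 : d ((x.seg 0 n zero_le hn).comp e h) = n + d e := by rw [d_comp, hd]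
    have h3 : toInf (n + d e) ≤ x.deg := e2 ▸ h2
    obtain ⟨h4, e4⟩ := x.init_comp_seg hf hd le_self_add h3
    exact ⟨e, he, h3, comp_left_cancel (e4.trans (h1.eq_seg e2 h3).symm)⟩

/-- Removes the condition that `E` omit the vertex, which `extSet` need not satisfy; if the vertex
is in `E`, it is itself the required member. -/
theorem IsBoundary.exists_init_comp {x : GraphPath Λ} (h : x.IsBoundary) {f : Mor Λ}
    (hf : x.Init f) {E : Set (Mor Λ)} (hE : E.Finite) (he : IsExhaustive f.src E) :
    ∃ e ∈ E, ∃ h : f.src = e.rng, x.Init (f.comp e h) := by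
  by_cases h0 : Mor.id f.src ∈ E
  · exact ⟨_, h0, rfl, by rwa [Mor.comp_id]⟩
  · exact isBoundary_iff.mp h f hf E ⟨hE, h0, he⟩

/-! ### Concatenations and shifts -/

theorem init_ofHeads {m : Fin k → ℕ∞} {y : ∀ q : Fin k → ℕ, toInf q ≤ m → Mor Λ}
    {hd : ∀ q hq, d (y q hq) = q}
    {hy : ∀ p q (h : p ≤ q) (hq : toInf q ≤ m),
      head (y q hq) p (h.trans (hd q hq).ge) = y p ((toInf_mono h).trans hq)} {f : Mor Λ} :
    (ofHeads m y hd hy).Init f ↔ ∃ h : toInf (d f) ≤ m, y (d f) h = f := by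
  have key : ∀ (g : Mor Λ) (h : 0 ≤ d g), tail g 0 h = g := fun g h =>
    (comp_inj (src_head g 0 h) rfl ((d_head _ _ _).trans (d_id _).symm)
      ((head_comp_tail g 0 h).trans (Mor.id_comp g _ rfl).symm)).2
  refine exists_congr fun h => ?_
  exact Eq.congr_left (key (y (d f) h) zero_le)

theorem init_concat {f : Mor Λ} {x : GraphPath Λ} {h : f.src = x.range} {t : Mor Λ} :
    (concat f x h).Init t ↔ ∃ (g : Mor Λ) (hg : f.src = g.rng), x.Init g ∧ Pre t (f.comp g hg) := by
  rw [concat, init_ofHeads]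
  constructor
  · rintro ⟨hd, e⟩
    have h1 := pre_head _ _ (le_d_preConcat f x h _ hd)
    rw [e] at h1
    exact ⟨_, _, x.init_seg _ _, h1⟩
  · rintro ⟨g, hg, hi, hp⟩
    have h0 : d t ≤ d f + d g := by simpa [d_comp] using d_mono hp
    have hd : toInf (d t) ≤ toInf (d f) + x.deg := fun i => by
      have a := h0 i
      have b := hi.1 i
      simp only [toInf, Pi.add_apply] at *
      calc (d t i : ℕ∞) ≤ d f i + d g i := by exact_mod_cast a
        _ ≤ _ := by gcongr
    refine ⟨hd, ?_⟩
    have h1 := pre_head _ _ (le_d_preConcat f x h _ hd)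
    refine eq_of_pre_of_pre (h1.trans ?_) hp (d_head _ _ _)
    refine Pre.comp_left f _ _ (Init.pre_of_le (x.init_seg _ _) hi ?_)
    rw [d_seg_zero]
    exact tsub_le_iff_left.mpr h0

theorem init_concat_comp {f : Mor Λ} {x : GraphPath Λ} {h : f.src = x.range} {g : Mor Λ}
    {hg : f.src = g.rng} : (concat f x h).Init (f.comp g hg) ↔ x.Init g := by
  rw [init_concat]
  constructor
  · rintro ⟨g', hg', hi, hp⟩
    exact hi.of_pre (pre_of_comp_pre hp)
  · exact fun hi => ⟨g, hg, hi, Pre.refl _⟩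

theorem init_concat_self (f : Mor Λ) (x : GraphPath Λ) (h : f.src = x.range) :
    (concat f x h).Init f :=
  init_concat.mpr ⟨_, h, x.init_id_range, pre_comp _ _ _⟩

theorem range_concat (f : Mor Λ) (x : GraphPath Λ) (h : f.src = x.range) :
    (concat f x h).range = f.rng :=
  (init_concat_self f x h).rng_eq.symm

theorem init_shift_comp {x : GraphPath Λ} {f g : Mor Λ} (hf : x.Init f) {n : Fin k → ℕ}
    (hd : d f = n) (hn : toInf n ≤ x.deg) :
    (x.shift n hn).Init g ↔ ∃ h : f.src = g.rng, x.Init (f.comp g h) := by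
  constructor
  · rintro ⟨h, e⟩
    have h3 : toInf (n + d g) ≤ x.deg := add_le_of_le_sub hn h
    obtain ⟨h4, e4⟩ := x.init_comp_seg hf hd le_self_add h3
    have e' : x.seg n (n + d g) le_self_add h3 = g := by
      refine Eq.trans ?_ e
      simp only [shift, add_zero]
    have h5 := x.init_seg _ h3
    rw [← e4] at h5
    exact ⟨h4.trans (congrArg Mor.rng e'), by simpa only [e'] using h5⟩
  · rintro ⟨h, hi⟩
    have e2 : d (f.comp g h) = n + d g := by rw [d_comp, hd]
    have h3 : toInf (n + d g) ≤ x.deg := e2 ▸ hi.1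
    obtain ⟨h4, e4⟩ := x.init_comp_seg hf hd le_self_add h3
    have e5 := comp_left_cancel (e4.trans (hi.eq_seg e2 h3).symm)
    refine ⟨?_, ?_⟩
    · have := le_shift_deg (n := n) h3
      rwa [add_tsub_cancel_left] at this
    · refine Eq.trans ?_ e5
      simp only [shift, add_zero]

theorem shift_concat (f : Mor Λ) (x : GraphPath Λ) (h : f.src = x.range)
    (hn : toInf (d f) ≤ (concat f x h).deg) : (concat f x h).shift (d f) hn = x := by
  refine ext_init fun g => ?_
  rw [init_shift_comp (init_concat_self f x h) rfl]
  constructor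
  · rintro ⟨hg, hi⟩
    exact init_concat_comp.mp hi
  · intro hi
    exact ⟨h.trans hi.rng_eq.symm, init_concat_comp.mpr hi⟩

theorem range_shift {x : GraphPath Λ} {f : Mor Λ} (hf : x.Init f) :
    f.src = (x.shift (d f) hf.1).range := by
  rw [hf.src_eq rfl hf.1]
  simp only [range, shift, add_zero]

theorem concat_shift {x : GraphPath Λ} {f : Mor Λ} (hf : x.Init f) :
    concat f (x.shift (d f) hf.1) (range_shift hf) = x := by
  refine ext_init fun g => ?_
  rw [init_concat]
  constructor
  · rintro ⟨a, ha, hi, hp⟩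
    obtain ⟨_, h1⟩ := (init_shift_comp hf rfl hf.1).mp hi
    exact h1.of_pre hp
  · intro hg
    obtain ⟨t, ht, ⟨a, ha, rfl⟩, h2⟩ := hf.exists_common hg
    exact ⟨a, ha, (init_shift_comp hf rfl hf.1).mpr ⟨ha, ht⟩, h2⟩

theorem concat_comp (f e : Mor Λ) (h : f.src = e.rng) (x : GraphPath Λ) (hx : e.src = x.range)
    (hx₁ : f.src = (concat e x hx).range) (hx₂ : (f.comp e h).src = x.range) :
    concat (f.comp e h) x hx₂ = concat f (concat e x hx) hx₁ := by
  refine ext_init fun g => ?_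
  simp only [init_concat]
  constructor
  · rintro ⟨a, ha, hi, hp⟩
    rw [Mor.comp_assoc f e a h ha] at hp
    exact ⟨e.comp a ha, h, ⟨a, ha, hi, Pre.refl _⟩, hp⟩
  · rintro ⟨b, hb, ⟨a, ha, hi, hp⟩, hp₁⟩
    refine ⟨a, ha, hi, ?_⟩
    rw [Mor.comp_assoc f e a h ha]
    exact hp₁.trans (Pre.comp_left f _ _ hp)

theorem concat_comp_shift (f : Mor Λ) {e : Mor Λ} (h : f.src = e.rng) {x : GraphPath Λ}
    (he : x.Init e) (hx : f.src = x.range)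
    (hx₁ : (f.comp e h).src = (x.shift (d e) he.1).range) :
    concat (f.comp e h) (x.shift (d e) he.1) hx₁ = concat f x hx := by
  refine (concat_comp f e h _ (range_shift he) ?_ hx₁).trans ?_
  · rw [concat_shift he]
    exact hx
  · simp only [concat_shift he]

theorem IsBoundary.shift {x : GraphPath Λ} (hx : x.IsBoundary) {f : Mor Λ} (hf : x.Init f) :
    (x.shift (d f) hf.1).IsBoundary := by
  refine isBoundary_iff.mpr fun g hg E hE => ?_
  obtain ⟨h, hi⟩ := (init_shift_comp hf rfl hf.1).mp hg
  obtain ⟨e, he, h1, hi1⟩ := isBoundary_iff.mp hx (f.comp g h) hi E hE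
  refine ⟨e, he, h1, (init_shift_comp hf rfl hf.1).mpr ⟨h, ?_⟩⟩
  exact Mor.comp_assoc f g e h h1 ▸ hi1

/-- An initial segment `g` of `fx` need not extend `f`, so `E` is not directly an exhaustive set
along `x`. Writing `gm = fa` with `a` initial in `x`, the set `Ext(m; E)` is exhaustive at `s(a)`,
and finite by finite alignment. The member `c` that `x` follows after `a` gives `fac = gmc`, which
extends some `ge`. -/
theorem IsBoundary.concat (hΛ : FinitelyAligned Λ) {x : GraphPath Λ} (hx : x.IsBoundary)
    (f : Mor Λ) (h : f.src = x.range) : (concat f x h).IsBoundary := by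
  refine isBoundary_iff.mpr fun g hg E hE => ?_
  obtain ⟨a, ha, hi, m, hm, hp⟩ := init_concat.mp hg
  have hex : IsExhaustive m.src (extSet m E) := by
    refine isExhaustive_extSet ?_
    rintro t ⟨b, hb, rfl⟩
    obtain ⟨e, he, hne⟩ := hE.2.2.2 (m.comp b hb) hm.symm
    obtain ⟨s, hs⟩ := minExt_nonempty_iff.mp hne
    exact ⟨e, he, s, hs⟩
  have hsrc : m.src = a.src := congrArg (fun t => t.src) hp
  rw [hsrc] at hex
  obtain ⟨c, hc, h1, hi1⟩ := IsBoundary.exists_init_comp hx hi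
    (extSet_finite hΛ m hE.1) hex
  obtain ⟨e, he, hpe⟩ := exists_pre_of_mem_extSet hc
  refine ⟨e, he, hm.trans hpe.rng_eq.symm, init_concat.mpr ⟨a.comp c h1, ha, hi1, ?_⟩⟩
  rw [← Mor.comp_assoc]
  have : (f.comp a ha).comp c h1 = g.comp (m.comp c (rng_of_mem_extSet hc)) hm := by
    rw [← Mor.comp_assoc g m c hm]
    simp only [hp]
  rw [this]
  exact Pre.comp_left g _ _ hpe

end GraphPath
end HigherRankGraph
namespace HigherRankGraph

open Mor

variable {k : ℕ} {Λ : Type u} [Category.{v} Λ] [HigherRankGraph k Λ]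

/-! ### Generic boundary paths -/

/-- Dependent choice: `P` is the invariant that keeps the construction going, and stage `n` moves
into `D n`. -/
theorem exists_chain {α : Type*} {r : α → α → Prop} (D : ℕ → Set α) (P : α → Prop)
    (hD : ∀ n a, P a → ∃ b ∈ D n, P b ∧ r a b) (a : α) (ha : P a) :
    ∃ c : ℕ → α, c 0 = a ∧ ∀ n, r (c n) (c (n + 1)) ∧ c (n + 1) ∈ D n := by
  choose F hF using fun n (a : {a // P a}) => hD n a.1 a.2
  let c : ℕ → {a // P a} := fun n =>
    Nat.rec ⟨a, ha⟩ (fun n b => ⟨F n b, (hF n b).2.1⟩) n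
  exact ⟨fun n => (c n).1, rfl, fun n => ⟨(hF n (c n)).2.2, (hF n (c n)).1⟩⟩

namespace GraphPath

/-- An increasing sequence of paths in `Λ` has a limit. -/
theorem exists_limit (c : ℕ → Mor Λ) (hc : ∀ n, Pre (c n) (c (n + 1))) :
    ∃ x : GraphPath Λ, ∀ f, x.Init f ↔ ∃ n, Pre f (c n) := by
  have mono : ∀ {m n}, m ≤ n → Pre (c m) (c n) := fun {m n} h => by
    induction h with
    | refl => exact Pre.refl _
    | step _ ih => exact ih.trans (hc _)
  let deg : Fin k → ℕ∞ := fun i => ⨆ n, (d (c n) i : ℕ∞)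
  have hle : ∀ n, toInf (d (c n)) ≤ deg := fun n i => le_iSup (fun n => (d (c n) i : ℕ∞)) n
  -- A finite `q` below the supremum is reached at a single stage: there are finitely many
  -- coordinates and the sequence increases.
  have hex : ∀ q : Fin k → ℕ, toInf q ≤ deg → ∃ n, q ≤ d (c n) := by
    intro q hq
    have h1 : ∀ i, ∃ n, q i ≤ d (c n) i := fun i => by
      by_contra! H
      have h2 : deg i ≤ ((q i - 1 : ℕ) : ℕ∞) := iSup_le fun n => by
        exact_mod_cast Nat.le_sub_one_of_lt (H n)
      -- With truncated subtraction this leaves only `q i = 0`, which `H 0` excludes.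
      have h3 : q i ≤ q i - 1 := Nat.cast_le.mp ((hq i).trans h2)
      have h4 := H 0
      omega
    choose N hN using h1
    exact ⟨Finset.univ.sup N, fun i =>
      (hN i).trans (d_mono (mono (Finset.le_sup (Finset.mem_univ i))) i)⟩
  choose N hN using hex
  have hhead : ∀ q hq n (h : q ≤ d (c n)), head (c (N q hq)) q (hN q hq) = head (c n) q h := by
    intro q hq n h
    have h1 := (pre_head (c (N q hq)) q (hN q hq)).trans (mono (le_max_left _ n))
    have h2 := (pre_head (c n) q h).trans (mono (le_max_right (N q hq) n))
    exact eq_of_pre_of_pre h1 h2 ((d_head _ _ _).trans (d_head _ _ _).symm)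
  refine ⟨ofHeads deg (fun q hq => head (c (N q hq)) q (hN q hq)) (fun _ _ => d_head _ _ _) ?_, ?_⟩
  · intro p q hpq hq
    rw [head_head _ _ _ hpq]
    exact (hhead p _ _ _).symm
  · intro f
    rw [init_ofHeads]
    constructor
    · rintro ⟨h, e⟩
      exact ⟨_, e ▸ pre_head _ _ (hN _ h)⟩
    · rintro ⟨n, hn⟩
      have h := (toInf_mono (d_mono hn)).trans (hle n)
      exact ⟨h, (hhead _ h n (d_mono hn)).trans (head_eq_of_pre hn _ rfl)⟩

/-- Every vertex is the range of a boundary path that meets each of countably many dense sets of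
paths. -/
theorem exists_isBoundary_meeting {ι : Type*} [Countable ι] (w : Λ) (D : ι → Set (Mor Λ))
    (hD : ∀ i f, f.rng = w → ∃ g ∈ D i, Pre f g) :
    ∃ x : GraphPath Λ, x.IsBoundary ∧ x.range = w ∧ ∀ i, ∃ f ∈ D i, x.Init f := by
  have := HigherRankGraph.countable_mor (Λ := Λ)
  have : Nonempty (Mor Λ) := ⟨Mor.id w⟩
  -- One dense set for each instance `(a, E)` of the boundary condition: a path in it either has no
  -- common extension with `a` or already extends `ae` for some `e ∈ E`. Since `Λ` is countable,
  -- there are countably many instances.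
  let B : Mor Λ × Finset (Mor Λ) → Set (Mor Λ) := fun p =>
    {g | IsFE p.1.src (p.2 : Set (Mor Λ)) → (∃ t, Pre g t ∧ Pre p.1 t) →
      ∃ e ∈ p.2, ∃ h : p.1.src = e.rng, Pre (p.1.comp e h) g}
  have hB : ∀ p f, ∃ g ∈ B p, Pre f g := by
    rintro ⟨a, E⟩ f
    by_cases h : IsFE a.src (E : Set (Mor Λ)) ∧ ∃ t, Pre f t ∧ Pre a t
    · obtain ⟨hE, t, hf, b, hb, rfl⟩ := h
      obtain ⟨e, he, hne⟩ := hE.2.2.2 b hb.symm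
      obtain ⟨s, hs, hes⟩ := minExt_nonempty_iff.mp hne
      have has : a.src = s.rng := hb.trans hs.rng_eq
      exact ⟨a.comp s has, fun _ _ => ⟨e, he, has.trans hes.rng_eq.symm, hes.comp_left a _ _⟩,
        hf.trans (hs.comp_left a _ _)⟩
    · exact ⟨f, fun h1 h2 => (h ⟨h1, h2⟩).elim, Pre.refl f⟩
  obtain ⟨φ, hφ⟩ := exists_surjective_nat (ι ⊕ (Mor Λ × Finset (Mor Λ)))
  obtain ⟨c, h0, hc⟩ := exists_chain (r := Pre) (fun n => Sum.elim D B (φ n))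
    (fun f => f.rng = w) (by
      intro n f hf
      have : ∃ b ∈ Sum.elim D B (φ n), Pre f b := by
        rcases φ n with i | p
        · exact hD i f hf
        · exact hB p f
      obtain ⟨b, hb, hp⟩ := this
      exact ⟨b, hb, hp.rng_eq ▸ hf, hp⟩) (Mor.id w) rfl
  obtain ⟨x, hx⟩ := exists_limit c fun n => (hc n).1
  have hi : ∀ n, x.Init (c n) := fun n => (hx _).mpr ⟨n, Pre.refl _⟩
  refine ⟨x, isBoundary_iff.mpr fun f hf E hE => ?_, ?_, fun i => ?_⟩
  · obtain ⟨n, hn⟩ := hφ (Sum.inr (f, hE.1.toFinset))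
    have h1 := (hc n).2
    simp only [hn, Sum.elim_inr] at h1
    -- Two initial segments of `x` always have a common extension, so the first alternative in `B`
    -- is ruled out.
    obtain ⟨t, _, h2, h3⟩ := (hi (n + 1)).exists_common hf
    obtain ⟨e, he, h, hp⟩ := h1 (by simpa using hE) ⟨t, h2, h3⟩
    exact ⟨e, by simpa using he, h, (hi _).of_pre hp⟩
  · rw [← (hi 0).rng_eq, h0]
    rfl
  · obtain ⟨n, hn⟩ := hφ (Sum.inl i)
    have h1 := (hc n).2
    simp only [hn, Sum.elim_inl] at h1
    exact ⟨_, h1, hi _⟩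

/-! ### What finite alignment gives for boundary paths, and the existence of aperiodic ones. -/

/-- If `fa` and `ga` have a common extension for every `a`, then `fx = gx` for every boundary
path `x`. -/
theorem concat_eq_of_common (hΛ : FinitelyAligned Λ) {f g : Mor Λ}
    (H : ∀ (a : Mor Λ) (hf : f.src = a.rng) (hg : g.src = a.rng),
      ∃ t, Pre (f.comp a hf) t ∧ Pre (g.comp a hg) t)
    {x : GraphPath Λ} (hx : x.IsBoundary) (hf : f.src = x.range) (hg : g.src = x.range) :
    concat f x hf = concat g x hg := by
  have key : ∀ {f g : Mor Λ}, (∀ (a : Mor Λ) (hf : f.src = a.rng) (hg : g.src = a.rng),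
      ∃ t, Pre (f.comp a hf) t ∧ Pre (g.comp a hg) t) →
      ∀ (hf : f.src = x.range) (hg : g.src = x.range) (t : Mor Λ),
      (concat f x hf).Init t → (concat g x hg).Init t := by
    intro f g H hf hg t ht
    obtain ⟨a, ha, hi, hp⟩ := init_concat.mp ht
    have hga : g.src = a.rng := hg.trans hi.rng_eq.symm
    -- `x` must follow `a` by some `b` in this finite exhaustive set; then `gab` extends `fa`, which
    -- extends `t`.
    have hex : IsExhaustive a.src (extSet (g.comp a hga) {f.comp a ha}) := by
      refine isExhaustive_extSet (f := g.comp a hga) ?_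
      rintro _ ⟨b, hb, rfl⟩
      obtain ⟨s, h1, h2⟩ := H (a.comp b hb) ha hga
      rw [← Mor.comp_assoc f a b ha hb] at h1
      rw [← Mor.comp_assoc g a b hga hb] at h2
      exact ⟨_, rfl, s, h2, (pre_comp _ _ _).trans h1⟩
    obtain ⟨b, hb, h1, hi1⟩ := hx.exists_init_comp hi
      (extSet_finite hΛ _ (Set.finite_singleton _)) hex
    obtain ⟨_, rfl, hpe⟩ := exists_pre_of_mem_extSet hb
    rw [Mor.comp_assoc g a b hga h1] at hpe
    exact init_concat.mpr ⟨a.comp b h1, hga, hi1, hp.trans hpe⟩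
  refine ext_init fun t => ⟨key H hf hg t, key (fun a ha hb => ?_) hg hf t⟩
  obtain ⟨t, h1, h2⟩ := H a hb ha
  exact ⟨t, h2, h1⟩

/-- If `f` is an initial segment of a boundary path `x` and no member of the finite set `N` is one,
then some extension of `f` has no common extension with any member of `N`. -/
theorem IsBoundary.exists_avoiding (hΛ : FinitelyAligned Λ) {x : GraphPath Λ} (hx : x.IsBoundary)
    {f : Mor Λ} (hf : x.Init f) {N : Set (Mor Λ)} (hN : N.Finite) (h : ∀ a ∈ N, ¬ x.Init a) :
    ∃ (r : Mor Λ) (hr : f.src = r.rng), ∀ a ∈ N, ¬ ∃ t, Pre (f.comp r hr) t ∧ Pre a t := by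
  by_contra! H
  -- Otherwise `x` would have to continue `f` into an extension of a member of `N`.
  have hex : IsExhaustive f.src (extSet f N) := by
    refine isExhaustive_extSet ?_
    rintro _ ⟨b, hb, rfl⟩
    exact H b hb
  obtain ⟨b, hb, h1, hi⟩ := hx.exists_init_comp hf (extSet_finite hΛ f hN) hex
  obtain ⟨e, he, hp⟩ := exists_pre_of_mem_extSet hb
  exact h e he (hi.of_pre hp)

end GraphPath

/-- If any two distinct paths with source `w` can be separated by a path with range `w`, then `w`
is the range of an aperiodic boundary path. -/
theorem exists_isAperiodic (w : Λ)
    (H : ∀ f g : Mor Λ, f ≠ g → f.src = g.src →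
      ∃ (a : Mor Λ) (hf : f.src = a.rng) (hg : g.src = a.rng),
        ¬ ∃ t, Pre (f.comp a hf) t ∧ Pre (g.comp a hg) t) :
    ∃ x : BoundaryPath Λ, x.1.range = w ∧ x.1.IsAperiodic := by
  have := HigherRankGraph.countable_mor (Λ := Λ)
  let D : {p : Mor Λ × Mor Λ // p.1 ≠ p.2 ∧ p.1.src = w ∧ p.2.src = w} → Set (Mor Λ) :=
    fun p => {a | ∃ (hf : p.1.1.src = a.rng) (hg : p.1.2.src = a.rng),
        ¬ ∃ t, Pre (p.1.1.comp a hf) t ∧ Pre (p.1.2.comp a hg) t}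
  obtain ⟨x, hx, hr, hD⟩ := GraphPath.exists_isBoundary_meeting w D (by
    rintro ⟨⟨f, g⟩, hne, rfl, hg⟩ b hb
    dsimp only at hne hg hb
    -- Density: the hypothesis is applied to `fb` and `gb`, which stay distinct by right
    -- cancellation, so separation is needed at every vertex and not just at `w`.
    obtain ⟨a, h1, h2, h3⟩ := H (f.comp b hb.symm) (g.comp b (hg.trans hb.symm))
      (fun h => hne (comp_right_cancel h)) rfl
    rw [Mor.comp_assoc f b a _ h1, Mor.comp_assoc g b a _ h1] at h3
    exact ⟨b.comp a h1, ⟨hb.symm, hg.trans hb.symm, h3⟩, pre_comp _ _ _⟩)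
  refine ⟨⟨x, hx⟩, hr, fun f g hf hg hne he => ?_⟩
  obtain ⟨a, ⟨h1, h2, h3⟩, hi⟩ := hD ⟨(f, g), hne, hf.trans hr, hg.trans hr⟩
  have e1 : (GraphPath.concat f x hf).Init (f.comp a h1) := GraphPath.init_concat_comp.mpr hi
  have e2 : (GraphPath.concat g x hg).Init (g.comp a h2) := GraphPath.init_concat_comp.mpr hi
  dsimp only at he
  rw [← he] at e2
  obtain ⟨t, _, ht⟩ := e1.exists_common e2
  exact h3 ⟨t, ht⟩

end HigherRankGraph
namespace HigherRankGraph

open Mor GraphPath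

variable {k : ℕ} {Λ : Type u} [Category.{v} Λ] [HigherRankGraph k Λ]

/-! ### The topology of the boundary-path groupoid -/

theorem mem_cylinder_iff {f : Mor Λ} {y : BoundaryPath Λ} : y ∈ cylinder f ↔ y.1.Init f := by
  constructor
  · rintro ⟨x, h, e⟩
    rw [e]
    exact init_concat_self _ _ _
  · intro h
    exact ⟨⟨_, y.2.shift h⟩, range_shift h, (concat_shift h).symm⟩

/-- Replaces the equation between shifts by a common tail `x`, with range `fx` and source `gx`. -/
theorem mem_bisection_iff {f g : Mor Λ} {a : Mor (BoundaryPath Λ)} :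
    a ∈ bisection f g ↔ (∀ i, lag a i = (d f i : ℤ) - (d g i : ℤ)) ∧
      ∃ (x : GraphPath Λ) (hf : f.src = x.range) (hg : g.src = x.range),
        a.rng.1 = concat f x hf ∧ a.src.1 = concat g x hg := by
  constructor
  · rintro ⟨h1, h2, h3, h4, h5, h6⟩
    rw [mem_cylinder_iff] at h1 h2
    refine ⟨h3, _, range_shift h1, ?_, (concat_shift h1).symm, ?_⟩
    · rw [h6]
      exact range_shift h2
    · simp only [h6]
      exact (concat_shift h2).symm
  · rintro ⟨h3, x, hf, hg, e1, e2⟩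
    have i1 : a.rng.1.Init f := e1 ▸ init_concat_self f x hf
    have i2 : a.src.1.Init g := e2 ▸ init_concat_self g x hg
    refine ⟨mem_cylinder_iff.mpr i1, mem_cylinder_iff.mpr i2, h3, i1.1, i2.1, ?_⟩
    simp only [e1, e2]
    rw [shift_concat, shift_concat]

theorem init_rng_of_mem_bisection {f g : Mor Λ} {a : Mor (BoundaryPath Λ)}
    (h : a ∈ bisection f g) : a.rng.1.Init f :=
  mem_cylinder_iff.mp h.1

theorem init_src_of_mem_bisection {f g : Mor Λ} {a : Mor (BoundaryPath Λ)}
    (h : a ∈ bisection f g) : a.src.1.Init g :=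
  mem_cylinder_iff.mp h.2.1

theorem bisection_comp_subset {f g e : Mor Λ} (hf : f.src = e.rng) (hg : g.src = e.rng) :
    bisection (f.comp e hf) (g.comp e hg) ⊆ bisection f g := by
  intro a ha
  obtain ⟨hl, x, h1, h2, e1, e2⟩ := mem_bisection_iff.mp ha
  have hr := range_concat e x h1
  refine mem_bisection_iff.mpr ⟨fun i => ?_, concat e x h1, hf.trans hr.symm, hg.trans hr.symm,
    e1.trans (concat_comp f e hf x h1 _ _), e2.trans (concat_comp g e hg x h1 _ _)⟩
  rw [hl i, d_comp, d_comp]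
  simp

/-- Range and source share their tail, so knowing that the range continues along `e` is enough. This
is why a neighbourhood can be described by conditions on the range alone. -/
theorem mem_bisection_comp {f g e : Mor Λ} (hf : f.src = e.rng) {a : Mor (BoundaryPath Λ)}
    (ha : a ∈ bisection f g) (hi : a.rng.1.Init (f.comp e hf)) :
    ∃ hg : g.src = e.rng, a ∈ bisection (f.comp e hf) (g.comp e hg) := by
  obtain ⟨hl, x, h1, h2, e1, e2⟩ := mem_bisection_iff.mp ha
  rw [e1, init_concat_comp] at hi
  have hg : g.src = e.rng := h2.trans hi.rng_eq.symm
  refine ⟨hg, mem_bisection_iff.mpr ⟨fun i => ?_, x.shift (d e) hi.1, range_shift hi,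
    range_shift hi, ?_, ?_⟩⟩
  · rw [hl i, d_comp, d_comp]
    simp
  · exact e1.trans (concat_comp_shift f hf hi h1 _).symm
  · exact e2.trans (concat_comp_shift g hg hi h2 _).symm

theorem exists_mem_bisection (a : Mor (BoundaryPath Λ)) : ∃ f g : Mor Λ, a ∈ bisection f g := by
  obtain ⟨p, q, hp, hq, hl, hs⟩ := a.hom.2
  refine ⟨_, _, mem_cylinder_iff.mpr (a.rng.1.init_seg p hp),
    mem_cylinder_iff.mpr (a.src.1.init_seg q hq), fun i => ?_, ?_⟩
  · rw [d_seg_zero, d_seg_zero]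
    exact (hl i).symm
  · simp only [d_seg_zero]
    exact ⟨hp, hq, hs⟩

/-- Every open neighbourhood of `a` contains a set of the form
`{b ∈ Z(f *ₛ g) : no member of N is an initial segment of r(b)}`, with `N` finite, that
contains `a`. -/
theorem exists_bisection_of_isOpen {U : Set (Mor (BoundaryPath Λ))} (hU : IsOpen U)
    {a : Mor (BoundaryPath Λ)} (ha : a ∈ U) :
    ∃ (f g : Mor Λ) (N : Set (Mor Λ)), N.Finite ∧ a ∈ bisection f g ∧
      (∀ n ∈ N, ¬ a.rng.1.Init n) ∧
      ∀ b ∈ bisection f g, (∀ n ∈ N, ¬ b.rng.1.Init n) → b ∈ U := by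
  induction hU with
  | basic U hU =>
    obtain ⟨f, g, G, hs, hG, hr, -, rfl⟩ := hU
    refine ⟨f, g, {t | ∃ e ∈ G, ∃ h : f.src = e.rng, f.comp e h = t}, ?_, ha.1, ?_, ?_⟩
    · have : {t | ∃ e ∈ G, ∃ h : f.src = e.rng, f.comp e h = t} =
          ⋃ e ∈ G, {t | ∃ h : f.src = e.rng, f.comp e h = t} := by
        ext t
        simp
      rw [this]
      refine hG.biUnion fun e _ => Set.Subsingleton.finite ?_
      rintro _ ⟨_, rfl⟩ _ ⟨_, rfl⟩
      rfl
    · rintro _ ⟨e, he, h, rfl⟩ hi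
      obtain ⟨hg, hb⟩ := mem_bisection_comp h ha.1 hi
      exact ha.2 ⟨e, he, h, hg, hb⟩
    · rintro b hb hN
      refine ⟨hb, ?_⟩
      rintro ⟨e, he, h, hg, hb₁⟩
      exact hN _ ⟨e, he, h, rfl⟩ (init_rng_of_mem_bisection hb₁)
  | univ =>
    obtain ⟨f, g, h⟩ := exists_mem_bisection a
    exact ⟨f, g, ∅, Set.finite_empty, h, by simp, by simp⟩
  | inter U V _ _ ihU ihV =>
    obtain ⟨f, g, N, hN, hb, hi, hU⟩ := ihU ha.1
    obtain ⟨f₁, g₁, N₁, hN₁, hb₁, hi₁, hV⟩ := ihV ha.2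
    obtain ⟨t, ht, ⟨e, he, h⟩, ⟨e₁, he₁, h₁⟩⟩ :=
      (init_rng_of_mem_bisection hb).exists_common (init_rng_of_mem_bisection hb₁)
    obtain ⟨hg, hc⟩ := mem_bisection_comp he hb (h ▸ ht)
    obtain ⟨hg₁, hc₁⟩ := mem_bisection_comp he₁ hb₁ (h₁ ▸ ht)
    -- Both sides are initial segments of the source of `a`. The lag of `a` and the common range
    -- segment `t` determine their degree.
    have hgg : g.comp e hg = g₁.comp e₁ hg₁ := by
      refine (init_src_of_mem_bisection hc).eq_of_d_eq (init_src_of_mem_bisection hc₁) ?_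
      funext i
      have l1 := hc.2.2.1 i
      have l2 := hc₁.2.2.1 i
      rw [h] at l1
      rw [h₁] at l2
      omega
    refine ⟨_, _, N ∪ N₁, hN.union hN₁, hc, ?_, fun b hb hbN => ⟨?_, ?_⟩⟩
    · rintro n (hn | hn)
      · exact hi n hn
      · exact hi₁ n hn
    · exact hU b (bisection_comp_subset he hg hb) fun n hn => hbN n (Or.inl hn)
    · refine hV b (bisection_comp_subset he₁ hg₁ ?_) fun n hn => hbN n (Or.inr hn)
      rw [h₁, ← hgg, ← h]
      exact hb
  | sUnion S _ ih =>
    obtain ⟨U, hU, haU⟩ := ha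
    obtain ⟨f, g, N, hN, hb, hi, h⟩ := ih U hU haU
    exact ⟨f, g, N, hN, hb, hi, fun b hb hn => ⟨U, hU, h b hb hn⟩⟩

theorem isOpen_bisection {f g : Mor Λ} (h : f.src = g.src) : IsOpen (bisection f g) := by
  refine TopologicalSpace.isOpen_generateFrom_of_mem
    ⟨f, g, ∅, h, Set.finite_empty, by simp, fun hE => ?_, ?_⟩
  -- The empty `G` is allowed because it is never exhaustive: the vertex itself has nothing to meet.
  · obtain ⟨_, h, _⟩ := hE.2 (Mor.id f.src) rfl
    exact h
  · simp [bisectionDiff]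

/-- The morphism `(fx, d(f) - d(g), gx)`. -/
theorem exists_mem_bisection_concat (hΛ : FinitelyAligned Λ) (f g : Mor Λ) (x : BoundaryPath Λ)
    (hf : f.src = x.1.range) (hg : g.src = x.1.range) :
    ∃ a ∈ bisection f g, a.rng.1 = concat f x.1 hf ∧ a.src.1 = concat g x.1 hg := by
  have i1 := init_concat_self f x.1 hf
  have i2 := init_concat_self g x.1 hg
  refine ⟨⟨⟨_, x.2.concat hΛ f hf⟩, ⟨_, x.2.concat hΛ g hg⟩,
    ⟨fun i => (d f i : ℤ) - d g i, d f, d g, i1.1, i2.1, fun _ => rfl, ?_⟩⟩,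
    mem_bisection_iff.mpr ⟨fun _ => rfl, x.1, hf, hg, rfl, rfl⟩, rfl, rfl⟩
  dsimp only
  rw [shift_concat, shift_concat]

/-! ### Units, isotropy, and the two implications. -/

theorem mem_unitSpace_iff {a : Mor (BoundaryPath Λ)} :
    a ∈ unitSpace (BoundaryPath Λ) ↔ a.src = a.rng ∧ lag a = 0 := by
  constructor
  · rintro ⟨x, rfl⟩
    exact ⟨rfl, rfl⟩
  · obtain ⟨x, y, m⟩ := a
    rintro ⟨h₁, h⟩
    dsimp only at h₁
    subst h₁
    refine ⟨y, ?_⟩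
    have : m = 𝟙 y := Subtype.ext h
    rw [this]
    rfl

/-- For a vertex `v`, the set `Z(v *ₛ v)` is open and consists of isotropy, since both ends equal
the common tail. This inclusion needs no hypothesis on `Λ`. -/
theorem unitSpace_subset_interior_isotropy :
    unitSpace (BoundaryPath Λ) ⊆ interior (isotropy (BoundaryPath Λ)) := by
  rintro _ ⟨x, rfl⟩
  refine mem_interior.mpr ⟨bisection (Mor.id x.1.range) (Mor.id x.1.range), ?_,
    isOpen_bisection rfl, ?_⟩
  · intro a ha
    obtain ⟨_, y, h1, h2, e1, e2⟩ := mem_bisection_iff.mp ha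
    exact Subtype.ext (e2.trans e1.symm)
  · have h : x ∈ cylinder (Mor.id x.1.range) := mem_cylinder_iff.mpr x.1.init_id_range
    exact ⟨h, h, fun i => (sub_self _).symm, x.1.init_id_range.1, x.1.init_id_range.1, rfl⟩

theorem Aperiodic.isEffective (hΛ : FinitelyAligned Λ) (hA : Aperiodic Λ) :
    IsEffective (BoundaryPath Λ) := by
  refine Set.Subset.antisymm (fun a ha => ?_) unitSpace_subset_interior_isotropy
  refine mem_unitSpace_iff.mpr ⟨interior_subset (s := isotropy _) ha, ?_⟩
  obtain ⟨f, g, N, hN, hb, hi, hU⟩ := exists_bisection_of_isOpen isOpen_interior ha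
  have hfg : f = g := by
    obtain ⟨_, x, h1, h2, _⟩ := mem_bisection_iff.mp hb
    obtain ⟨r, hr, hav⟩ :=
      a.rng.2.exists_avoiding hΛ (init_rng_of_mem_bisection hb) hN hi
    have hgr : g.src = r.rng := (h2.trans h1.symm).trans hr
    obtain ⟨z, hz, haz⟩ := hA r.src
    obtain ⟨b, hbb, e1, e2⟩ := exists_mem_bisection_concat hΛ (f.comp r hr) (g.comp r hgr) z
      hz.symm hz.symm
    -- A forbidden initial segment of `frz` would have a common extension with `fr`, against the
    -- choice of `r`.
    have hb₁ := hU b (bisection_comp_subset hr hgr hbb) fun n hn hni => by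
      obtain ⟨t, _, ht⟩ := (init_rng_of_mem_bisection hbb).exists_common hni
      exact hav n hn ⟨t, ht⟩
    have hb₂ : b.src = b.rng := interior_subset (s := isotropy _) hb₁
    by_contra hne
    refine haz (f.comp r hr) (g.comp r hgr) hz.symm hz.symm
      (fun h => hne (comp_right_cancel h)) ?_
    rw [← e1, ← e2, hb₂]
  funext i
  rw [hb.2.2.1 i, hfg]
  simp

theorem aperiodic_of_isEffective (hΛ : FinitelyAligned Λ)
    (hE : IsEffective (BoundaryPath Λ)) : Aperiodic Λ := by
  intro w
  refine exists_isAperiodic w fun f g hne hs => ?_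
  by_contra! H
  have heq : ∀ (x : GraphPath Λ), x.IsBoundary → ∀ (hf : f.src = x.range) (hg : g.src = x.range),
      concat f x hf = concat g x hg := fun x hx hf hg => concat_eq_of_common hΛ H hx hf hg
  -- With no dense sets prescribed this just supplies a boundary path at `s(f)`, so that `Z(f *ₛ g)`
  -- is not empty.
  obtain ⟨x, hx, hr, -⟩ := exists_isBoundary_meeting f.src (fun i : Empty => i.elim)
    (fun i => i.elim)
  obtain ⟨a, ha, e1, e2⟩ := exists_mem_bisection_concat hΛ f g ⟨x, hx⟩ hr.symm
    (hs.symm.trans hr.symm)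
  have hsub : bisection f g ⊆ isotropy (BoundaryPath Λ) := by
    intro b hb
    have h1 := init_rng_of_mem_bisection hb
    obtain ⟨_, y, hf, hg, e1, e2⟩ := mem_bisection_iff.mp hb
    have hy : y.IsBoundary := by
      have := b.rng.2.shift h1
      simp only [e1] at this
      rwa [shift_concat] at this
    exact Subtype.ext (e2.trans ((heq y hy hf hg).symm.trans e1.symm))
  have hmem := interior_maximal hsub (isOpen_bisection hs) ha
  rw [hE, mem_unitSpace_iff] at hmem
  have hl := ha.2.2.1
  rw [hmem.2] at hl
  have hd : d f = d g := funext fun i => by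
    have := hl i
    simp only [Pi.zero_apply] at this
    omega
  -- As `a` is a unit, `f` and `g` are initial segments of the same path, and they have equal degree
  -- because its lag is zero.
  refine hne ((init_rng_of_mem_bisection ha).eq_of_d_eq ?_ hd)
  rw [← hmem.1]
  exact init_src_of_mem_bisection ha

end HigherRankGraph

theorem mainTheorem7 {k : ℕ} (hk : 0 < k) (Λ : Type u) [Category.{v} Λ] [HigherRankGraph k Λ]
    (hΛ : HigherRankGraph.FinitelyAligned Λ) :
    HigherRankGraph.Aperiodic Λ ↔ IsEffective (HigherRankGraph.BoundaryPath Λ) :=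
  ⟨HigherRankGraph.Aperiodic.isEffective hΛ, HigherRankGraph.aperiodic_of_isEffective hΛ⟩
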